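/- Let $d\ge 1$ be an integer and, for $f\in L_1(\mathbb T^d)$ (functions on $\mathbb R^d$ that are $2\pi$-periodic in each variable and integrable over $[0,2\pi]^d$), let $\widehat f(\mathbf k)=(2\pi)^{-d}\int_{[0,2\pi]^d}f(\mathbf x)e^{-i(\mathbf k,\mathbf x)}\,d\mathbf x$, $\mathbf k\in\mathbb Z^d$, and $\|f\|_{S^p}=\big(\sum_{\mathbf k\in\mathbb Z^d}|\widehat f(\mathbf k)|^p\big)^{1/p}\in[0,\infty]$. For a class $\mathfrak N\subset L_1(\mathbb T^d)$ put $$e_n(\mathfrak N)_{S^p}=\sup_{f\in\mathfrak N}\ \inf_{\gamma_n,\,c_{\mathbf k}}\Big\|f-\sum_{\mathbf k\in\gamma_n}c_{\mathbf k}e^{i(\mathbf k,\cdot)}\Big\|_{S^p},$$ where $\gamma_n$ runs over the sets of $n$ distinct vectors of $\mathbb Z^d$ and the $c_{\mathbf k}$ over the complex numbers. Let $|\mathbf k|_r=\big(\sum_j|k_j|^r\big)^{1/r}$ for $r<\infty$ and $|\mathbf k|_\infty=\max_j|k_j|$. For a positive nonincreasing function $\psi$ on $[1,\infty)$, with $\psi(0):=\psi(1)$,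 let $$F^\psi_{q,r}=\Big\{f\in L_1(\mathbb T^d):\ \Big(\sum_{\mathbf k\in\mathbb Z^d}\big(|\widehat f(\mathbf k)|/\psi(|\mathbf k|_r)\big)^q\Big)^{1/q}\le 1\Big\}.$$ Let $B$ be the set of positive nonincreasing functions $\varphi$ on $[1,\infty)$ with $\lim_{t\to\infty}\varphi(t)=0$ for which there are constants $c>1$ and $K>0$ such that $1<\varphi(t)/\varphi(ct)\le K$ for all $t\ge 1$. **Corollary 4.1.** Let $1\le p<\infty$, $0<q<\infty$, and let $\psi$ be a positive nonincreasing function on $[1,\infty)$ with $\psi^p\in B$. If $p<q$, assume moreover that there are numbers $t_0$ and $K_\psi>d\left(\frac1p-\frac1q\right)$ such that $\psi^p$ is convex on $(t_0,\infty)$ and $$\frac{t\,|\psi'(t+)|}{\psi(t)}\ge K_\psi\qquad\text{for all } t>t_0,$$ where $\psi'(t+)$ is the right derivative. Then for every $r$ with $1\le r\le\infty$ $$e_n(F^\psi_{q,r})_{S^p}\asymp \psi(n^{1/d})\,n^{\frac1p-\frac1q},$$ that is, there are constants $0<K_1<K_2$ such that $K_1\,\psi(n^{1/d})\,n^{\frac1p-\frac1q}\le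 e_n(F^\psi_{q,r})_{S^p}\le K_2\,\psi(n^{1/d})\,n^{\frac1p-\frac1q}$ for all $n=1,2,\dots$ -/

import Mathlib

open Set Filter Topology MeasureTheory
open scoped ENNReal

noncomputable section

namespace TrigApprox

variable {d : ℕ}

/-- The exponential `x ↦ e^{i(k,x)}` on `ℝ^d`, for `k ∈ ℤ^d`. -/
def trigExp (k : Fin d → ℤ) (x : Fin d → ℝ) : ℂ :=
  Complex.exp (Complex.I * ((∑ j, (k j : ℝ) * x j : ℝ) : ℂ))

/-- The box `[0, 2π]^d`. -/
def torusBox (d : ℕ) : Set (Fin d → ℝ) :=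
  Set.Icc (fun _ => 0) (fun _ => 2 * Real.pi)

/-- `f ∈ L_1(𝕋^d)`: `f` is `2π`-periodic in each variable and integrable over `[0, 2π]^d`. -/
structure MemL1 (f : (Fin d → ℝ) → ℂ) : Prop where
  periodic : ∀ (j : Fin d) (x : Fin d → ℝ), f (x + Pi.single j (2 * Real.pi)) = f x
  integrableOn : IntegrableOn f (torusBox d) volume

/-- The Fourier coefficient `(2π)^{-d} ∫_{[0,2π]^d} f(x) e^{-i(k,x)} dx`. -/
def fourierCoef (f : (Fin d → ℝ) → ℂ) (k : Fin d → ℤ) : ℂ :=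
  ((2 * (Real.pi : ℂ)) ^ d)⁻¹ * ∫ x in torusBox d, f x * trigExp (-k) x

/-- The `l_p(ℤ^d)` (quasi-)norm of a family of complex numbers, `0 < p < ∞`, with values
in `[0, ∞]`. -/
def seqNorm (p : ℝ) (a : (Fin d → ℤ) → ℂ) : ℝ≥0∞ :=
  (∑' k, ‖a k‖ₑ ^ p) ^ (1 / p)

/-- The (quasi-)norm of `f` in `S^p(𝕋^d)`, with value `∞` if `f` is not in `S^p(𝕋^d)`. -/
def sNorm (p : ℝ) (f : (Fin d → ℝ) → ℂ) : ℝ≥0∞ :=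
  seqNorm p (fourierCoef f)

/-- The `l_r` (quasi-)norm `|k|_r` of `k ∈ ℤ^d`, `0 < r ≤ ∞`. -/
def vecNorm (r : ℝ≥0∞) (k : Fin d → ℤ) : ℝ :=
  ‖(WithLp.toLp r (fun j => (k j : ℝ)) : PiLp r (fun _ : Fin d => ℝ))‖

/-- A function `ψ` on `[1, ∞)`, extended to the point `0` by `ψ(0) := ψ(1)`. -/
def extendZero (ψ : ℝ → ℝ) (t : ℝ) : ℝ :=
  if t = 0 then ψ 1 else ψ t

/-- The class `F^ψ_{q,r}` of all `f ∈ L_1(𝕋^d)` such that the `l_q(ℤ^d)` (quasi-)norm of the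
family `f̂(k) / ψ(|k|_r)` is at most `1`. -/
def classF (d : ℕ) (q : ℝ) (r : ℝ≥0∞) (ψ : ℝ → ℝ) : Set ((Fin d → ℝ) → ℂ) :=
  {f | MemL1 f ∧
    seqNorm q (fun k => fourierCoef f k / (extendZero ψ (vecNorm r k) : ℂ)) ≤ 1}

/-- The best `n`-term trigonometric approximation of `f` in `S^p(𝕋^d)`. -/
def bestNTerm (p : ℝ) (n : ℕ) (f : (Fin d → ℝ) → ℂ) : ℝ≥0∞ :=
  ⨅ (γ : Finset (Fin d → ℤ)) (_ : γ.card = n) (c : (Fin d → ℤ) → ℂ),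
    sNorm p (fun x => f x - ∑ k ∈ γ, c k * trigExp k x)

/-- The best `n`-term trigonometric approximation of a class of functions in `S^p(𝕋^d)`. -/
def bestNTermClass (p : ℝ) (n : ℕ) (N : Set ((Fin d → ℝ) → ℂ)) : ℝ≥0∞ :=
  ⨆ f ∈ N, bestNTerm p n f

/-- The set `B` of positive nonincreasing functions `φ` on `[1, ∞)` that tend to `0` at infinity
and satisfy `1 < φ(t) / φ(ct) ≤ K` for all `t ≥ 1`, with some constants `c > 1` and `K > 0`. -/
def classB : Set (ℝ → ℝ) :=
  {φ | (∀ t, 1 ≤ t → 0 < φ t) ∧ AntitoneOn φ (Set.Ici 1) ∧ Tendsto φ atTop (𝓝 0) ∧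
    ∃ c > 1, ∃ K > 0, ∀ t, 1 ≤ t → 1 < φ t / φ (c * t) ∧ φ t / φ (c * t) ≤ K}

/-- `α(ψ, t) = ψ(t) / (t |ψ'(t)|)`, where `ψ'(t)` is the right derivative. If `ψ'(t) = 0`, then
`1 / α(ψ, t)` is `0`, as it should be. -/
def alphaChar (ψ : ℝ → ℝ) (t : ℝ) : ℝ :=
  ψ t / (t * |derivWithin ψ (Set.Ioi t) t|)

/-- `a(n) ≍ b(n)`: there are constants `0 < K₁ < K₂` with `K₁ b(n) ≤ a(n) ≤ K₂ b(n)` for all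
`n = 1, 2, …`. -/
def SameOrder (a : ℕ → ℝ≥0∞) (b : ℕ → ℝ) : Prop :=
  ∃ K₁ K₂ : ℝ, 0 < K₁ ∧ K₁ < K₂ ∧ ∀ n : ℕ, 1 ≤ n →
    ENNReal.ofReal (K₁ * b n) ≤ a n ∧ a n ≤ ENNReal.ofReal (K₂ * b n)

end TrigApprox

end

/-! ### Fourier coefficients of trigonometric polynomials and `n`-term errors -/

namespace TrigApprox
variable {d : ℕ}

/-! On the Fourier side the problem is discrete: approximate, in `l_p`, sequences `b_k W_k` with `∑
b_k^q ≤ 1` and `W_k = ψ(max(1, |k|_r))`, by keeping `n` entries. Membership of `ψ^p` in `B` makes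
`ψ` doubling (`exists_doubling`), so comparable radii are interchangeable and all `|·|_r` may be
compared with the sup norm.

Lower bound: take `2n` equal coefficients in a box of side about `n^{1/d}`. Any `n` frequencies miss
`n` of them, each of size about `n^{-1/q} ψ(n^{1/d})`.

Upper bound: spend at most `n/2` frequencies on a box of side `m ~ n^{1/d}`. If `q ≤ p`, the weights
outside are at most `ψ(max(m, 1))`, and the other `n/2` frequencies remove the large `b_k`
(`exists_finset_tsum_rpow_le_of_le`). If `p < q`, Hölder (`tsum_rpow_le_of_lt`) leaves the `l_s`
norm of the outer weights, `1/s = 1/p - 1/q`. The derivative condition gives decay of order `K >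
d/s` (`exists_decay`), so the lattice sum converges and is `O(n)` relative to `ψ(m)^s`
(`exists_tsum_rpow_le`). -/

theorem trigExp_continuous (k : Fin d → ℤ) : Continuous (trigExp k) := by
  unfold trigExp
  fun_prop

theorem trigExp_eq_prod (k : Fin d → ℤ) (x : Fin d → ℝ) :
    trigExp k x = ∏ j, Complex.exp (Complex.I * (k j : ℂ) * (x j : ℂ)) := by
  rw [trigExp, ← Complex.exp_sum]
  push_cast
  rw [Finset.mul_sum]
  simp only [mul_assoc]

theorem trigExp_mul (k l : Fin d → ℤ) (x : Fin d → ℝ) :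
    trigExp k x * trigExp l x = trigExp (k + l) x := by
  simp only [trigExp, ← Complex.exp_add, Pi.add_apply, ← mul_add]
  push_cast
  simp only [add_mul, Finset.sum_add_distrib]

theorem trigExp_periodic (k : Fin d → ℤ) (j : Fin d) (x : Fin d → ℝ) :
    trigExp k (x + Pi.single j (2 * Real.pi)) = trigExp k x := by
  have h : ∑ i, (k i : ℝ) * (x + Pi.single j (2 * Real.pi) : Fin d → ℝ) i
      = ∑ i, (k i : ℝ) * x i + (k j : ℝ) * (2 * Real.pi) := by
    simp only [Pi.add_apply, mul_add, Finset.sum_add_distrib]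
    simp [Pi.single_apply]
  rw [trigExp, trigExp, h, Complex.exp_eq_exp_iff_exists_int]
  exact ⟨k j, by push_cast; ring⟩

theorem integrableOn_trigExp (k : Fin d → ℤ) : IntegrableOn (trigExp k) (torusBox d) volume :=
  (trigExp_continuous k).continuousOn.integrableOn_compact isCompact_Icc

theorem norm_trigExp (k : Fin d → ℤ) (x : Fin d → ℝ) : ‖trigExp k x‖ = 1 := by
  rw [trigExp, mul_comm, Complex.norm_exp_ofReal_mul_I]

theorem integrableOn_mul_trigExp {f : (Fin d → ℝ) → ℂ} (hf : IntegrableOn f (torusBox d) volume)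
    (k : Fin d → ℤ) : IntegrableOn (fun x => f x * trigExp k x) (torusBox d) volume :=
  Integrable.mul_bdd (c := 1) hf (trigExp_continuous k).aestronglyMeasurable
    (ae_of_all _ fun x => (norm_trigExp k x).le)

theorem integral_exp_int (m : ℤ) :
    ∫ x in Icc (0 : ℝ) (2 * Real.pi), Complex.exp (Complex.I * (m : ℂ) * (x : ℂ))
      = if m = 0 then 2 * (Real.pi : ℂ) else 0 := by
  have h0 : (0 : ℝ) ≤ 2 * Real.pi := by positivity
  rw [integral_Icc_eq_integral_Ioc, ← intervalIntegral.integral_of_le h0]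
  split_ifs with h
  · simp [h]
  · have hm : Complex.I * (m : ℂ) ≠ 0 := by simp [h]
    rw [integral_exp_mul_complex hm]
    have : Complex.exp (Complex.I * (m : ℂ) * ((2 * Real.pi : ℝ) : ℂ)) = 1 := by
      rw [Complex.exp_eq_one_iff]
      exact ⟨m, by push_cast; ring⟩
    rw [this]
    simp

theorem integral_trigExp (k : Fin d → ℤ) :
    ∫ x in torusBox d, trigExp k x = if k = 0 then (2 * (Real.pi : ℂ)) ^ d else 0 := by
  have hbox : torusBox d = Set.univ.pi fun _ => Icc (0 : ℝ) (2 * Real.pi) := by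
    rw [torusBox, ← Set.pi_univ_Icc]
  rw [hbox, volume_pi, Measure.restrict_pi_pi]
  simp only [trigExp_eq_prod]
  rw [integral_fintype_prod_eq_prod (𝕜 := ℂ)
    (f := fun j (t : ℝ) => Complex.exp (Complex.I * (k j : ℂ) * (t : ℂ)))]
  simp only [integral_exp_int]
  split_ifs with h
  · simp [h]
  · obtain ⟨j, hj⟩ := Function.ne_iff.1 h
    exact Finset.prod_eq_zero (Finset.mem_univ j) (if_neg hj)

theorem fourierCoef_trigExp (k l : Fin d → ℤ) :
    fourierCoef (trigExp k) l = if l = k then 1 else 0 := by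
  have hpi : (2 * (Real.pi : ℂ)) ^ d ≠ 0 := by simp [Real.pi_ne_zero]
  simp only [fourierCoef, trigExp_mul, integral_trigExp, ← sub_eq_add_neg, sub_eq_zero]
  by_cases h : l = k
  · simp only [h, if_true]
    exact inv_mul_cancel₀ hpi
  · rw [if_neg (Ne.symm h), if_neg h, mul_zero]

theorem memL1_trigPoly (γ : Finset (Fin d → ℤ)) (c : (Fin d → ℤ) → ℂ) :
    MemL1 (fun x => ∑ k ∈ γ, c k * trigExp k x) where
  periodic j x := by simp only [trigExp_periodic]
  integrableOn := integrable_finsetSum _ fun k _ => (integrableOn_trigExp k).const_mul (c k)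

theorem fourierCoef_sub {f g : (Fin d → ℝ) → ℂ} (hf : IntegrableOn f (torusBox d) volume)
    (hg : IntegrableOn g (torusBox d) volume) (l : Fin d → ℤ) :
    fourierCoef (fun x => f x - g x) l = fourierCoef f l - fourierCoef g l := by
  simp only [fourierCoef, sub_mul]
  rw [integral_sub (integrableOn_mul_trigExp hf _) (integrableOn_mul_trigExp hg _), mul_sub]

theorem fourierCoef_trigPoly (γ : Finset (Fin d → ℤ)) (c : (Fin d → ℤ) → ℂ) (l : Fin d → ℤ) :
    fourierCoef (fun x => ∑ k ∈ γ, c k * trigExp k x) l = if l ∈ γ then c l else 0 := by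
  have h : ∀ k, ((2 * (Real.pi : ℂ)) ^ d)⁻¹ * ∫ x in torusBox d, c k * trigExp k x * trigExp (-l) x
      = c k * if l = k then 1 else 0 := by
    intro k
    rw [← fourierCoef_trigExp, fourierCoef]
    simp only [mul_assoc]
    rw [integral_const_mul]
    ring
  simp only [fourierCoef, Finset.sum_mul]
  rw [integral_finsetSum _ fun k _ =>
    integrableOn_mul_trigExp ((integrableOn_trigExp k).const_mul (c k)) _, Finset.mul_sum]
  simp only [h, mul_ite, mul_one, mul_zero, Finset.sum_ite_eq]

theorem fourierCoef_sub_trigPoly {f : (Fin d → ℝ) → ℂ} (hf : MemL1 f)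
    (γ : Finset (Fin d → ℤ)) (c : (Fin d → ℤ) → ℂ) (l : Fin d → ℤ) :
    fourierCoef (fun x => f x - ∑ k ∈ γ, c k * trigExp k x) l
      = fourierCoef f l - if l ∈ γ then c l else 0 := by
  rw [fourierCoef_sub hf.integrableOn (memL1_trigPoly γ c).integrableOn, fourierCoef_trigPoly]

theorem bestNTerm_le (hd : 1 ≤ d) {p : ℝ} (hp : 0 < p) {n : ℕ} {f : (Fin d → ℝ) → ℂ}
    (hf : MemL1 f) {A : Finset (Fin d → ℤ)} (hA : A.card ≤ n) :
    bestNTerm p n f ≤ (∑' k, if k ∈ A then 0 else ‖fourierCoef f k‖ₑ ^ p) ^ (1 / p) := by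
  have : Nonempty (Fin d) := ⟨⟨0, hd⟩⟩
  -- Exactly `n` frequencies are required, so `A` is padded; the extra ones only lower the error.
  obtain ⟨γ, hAγ, hγ⟩ := Infinite.exists_superset_card_eq A n hA
  refine (iInf₂_le γ hγ).trans ((iInf_le _ (fourierCoef f)).trans ?_)
  refine ENNReal.rpow_le_rpow (ENNReal.tsum_le_tsum fun k => ?_) (by positivity)
  rw [fourierCoef_sub_trigPoly hf]
  by_cases hk : k ∈ γ
  · simp [hk, hp]
  · have hkA : k ∉ A := fun h => hk (hAγ h)
    simp [hk, hkA]

/-- Any `n` frequencies leave at least `n` of the `2n` or more equal coefficients untouched. -/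
theorem le_bestNTerm_trigPoly {p : ℝ} (hp : 0 < p) {n : ℕ} {N : Finset (Fin d → ℤ)}
    (hN : 2 * n ≤ N.card) (a : ℂ) :
    ((n : ℝ≥0∞) * ‖a‖ₑ ^ p) ^ (1 / p) ≤ bestNTerm p n fun x => ∑ k ∈ N, a * trigExp k x := by
  refine le_iInf₂ fun γ hγ => le_iInf fun c => ENNReal.rpow_le_rpow ?_ (by positivity)
  calc (n : ℝ≥0∞) * ‖a‖ₑ ^ p ≤ ∑ k ∈ N \ γ, ‖a‖ₑ ^ p := by
        rw [Finset.sum_const, nsmul_eq_mul]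
        gcongr
        have := Finset.le_card_sdiff γ N
        omega
    _ = ∑ k ∈ N \ γ, ‖fourierCoef (fun x => (∑ k ∈ N, a * trigExp k x)
          - ∑ k ∈ γ, c k * trigExp k x) k‖ₑ ^ p := by
        refine Finset.sum_congr rfl fun k hk => ?_
        rw [Finset.mem_sdiff] at hk
        rw [fourierCoef_sub_trigPoly (memL1_trigPoly N fun _ => a),
          fourierCoef_trigPoly N fun _ => a, if_pos hk.1, if_neg hk.2, sub_zero]
    _ ≤ _ := ENNReal.sum_le_tsum _


/-! ### Comparison of `|k|_r` with the sup norm -/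

theorem norm_le_vecNorm {r : ℝ≥0∞} (hr : 1 ≤ r) (k : Fin d → ℤ) : ‖k‖ ≤ vecNorm r k := by
  have : Fact (1 ≤ r) := ⟨hr⟩
  refine (pi_norm_le_iff_of_nonneg (norm_nonneg _)).2 fun j => ?_
  have := PiLp.norm_apply_le (WithLp.toLp r (fun j => (k j : ℝ)) : PiLp r (fun _ : Fin d => ℝ)) j
  simpa [vecNorm, Int.norm_eq_abs] using this

theorem vecNorm_le_mul_norm {r : ℝ≥0∞} (hr : 1 ≤ r) (k : Fin d → ℤ) :
    vecNorm r k ≤ d * ‖k‖ := by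
  have : Fact (1 ≤ r) := ⟨hr⟩
  have h : (WithLp.toLp r (fun j => (k j : ℝ)) : PiLp r (fun _ : Fin d => ℝ))
      = ∑ j, PiLp.single r j (k j : ℝ) := by
    ext i
    simp
  calc vecNorm r k ≤ ∑ j, ‖(PiLp.single r j (k j : ℝ) : PiLp r (fun _ : Fin d => ℝ))‖ := by
        rw [vecNorm, h]; exact norm_sum_le _ _
    _ ≤ ∑ _j : Fin d, ‖k‖ := by
        refine Finset.sum_le_sum fun j _ => ?_
        rw [PiLp.norm_single]
        simpa [Int.norm_eq_abs] using norm_le_pi_norm k j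
    _ = d * ‖k‖ := by simp

theorem one_le_norm {k : Fin d → ℤ} (hk : k ≠ 0) : 1 ≤ ‖k‖ := by
  obtain ⟨j, hj⟩ := Function.ne_iff.1 hk
  refine le_trans ?_ (norm_le_pi_norm k j)
  rw [Int.norm_eq_abs]
  exact_mod_cast Int.one_le_abs hj

/-- Nonzero integer vectors have norm at least `1`, so the convention at `0` amounts to truncating
the argument at `1`. -/
theorem extendZero_vecNorm {r : ℝ≥0∞} (hr : 1 ≤ r) (ψ : ℝ → ℝ) (k : Fin d → ℤ) :
    extendZero ψ (vecNorm r k) = ψ (max 1 (vecNorm r k)) := by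
  by_cases hk : k = 0
  · have h0 : vecNorm r k = 0 := by
      have h1 := norm_le_vecNorm hr k
      have h2 := vecNorm_le_mul_norm hr k
      simp only [hk, norm_zero, mul_zero] at h1 h2 ⊢
      exact le_antisymm h2 h1
    simp [h0, extendZero]
  · have h := (one_le_norm hk).trans (norm_le_vecNorm hr k)
    rw [extendZero, if_neg (by linarith), max_eq_right h]

/-! ### Doubling and power decay of the weight -/

section Weight

variable {ψ : ℝ → ℝ} {p : ℝ}

/-- Iterate the bound from `B`, after taking `p`-th roots, until `c ^ j` exceeds `A`; monotonicity
does the rest. -/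
theorem exists_doubling (hψ_pos : ∀ t, 1 ≤ t → 0 < ψ t) (hψ_anti : AntitoneOn ψ (Set.Ici 1))
    (hp : 0 < p) (hψB : (fun t => ψ t ^ p) ∈ classB) (A : ℝ) :
    ∃ C : ℝ, 0 < C ∧ ∀ s t, 1 ≤ s → 1 ≤ t → s ≤ A * t → ψ t ≤ C * ψ s := by
  obtain ⟨-, -, -, c, hc, K, hK, h⟩ := hψB
  have step : ∀ t, 1 ≤ t → ψ t ≤ K ^ (1 / p) * ψ (c * t) := by
    intro t ht
    have hct : 1 ≤ c * t := by nlinarith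
    have h2 := (div_le_iff₀ (Real.rpow_pos_of_pos (hψ_pos _ hct) p)).1 (h t ht).2
    have h3 := Real.rpow_le_rpow (Real.rpow_nonneg (hψ_pos t ht).le p) h2
      (by positivity : 0 ≤ 1 / p)
    rw [Real.mul_rpow hK.le (Real.rpow_nonneg (hψ_pos _ hct).le p),
      ← Real.rpow_mul (hψ_pos t ht).le, ← Real.rpow_mul (hψ_pos _ hct).le,
      mul_one_div_cancel hp.ne', Real.rpow_one, Real.rpow_one] at h3
    exact h3
  have iter : ∀ j : ℕ, ∀ t, 1 ≤ t → ψ t ≤ (K ^ (1 / p)) ^ j * ψ (c ^ j * t) := by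
    intro j
    induction j with
    | zero => intro t _; simp
    | succ j ih =>
      intro t ht
      have hct : 1 ≤ c ^ j * t := by
        have := one_le_pow₀ hc.le (n := j)
        nlinarith
      calc ψ t ≤ (K ^ (1 / p)) ^ j * ψ (c ^ j * t) := ih t ht
        _ ≤ (K ^ (1 / p)) ^ j * (K ^ (1 / p) * ψ (c * (c ^ j * t))) := by
            gcongr; exact step _ hct
        _ = _ := by rw [show c * (c ^ j * t) = c ^ (j + 1) * t by ring]; ring
  obtain ⟨j, hj⟩ := pow_unbounded_of_one_lt A hc
  refine ⟨(K ^ (1 / p)) ^ j, by positivity, fun s t hs ht hst => (iter j t ht).trans ?_⟩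
  have hle : s ≤ c ^ j * t := hst.trans (by gcongr)
  gcongr
  exact hψ_anti hs (hs.trans hle) hle

theorem derivWithin_nonpos_of_antitoneOn (hψ_anti : AntitoneOn ψ (Set.Ici 1)) {t : ℝ}
    (ht : 1 ≤ t) : derivWithin ψ (Ioi t) t ≤ 0 := by
  have : AntitoneOn ψ (Ici t) := hψ_anti.mono (Ici_subset_Ici.2 ht)
  rw [derivWithin_Ioi_eq_Ici]
  exact this.derivWithin_nonpos

/-- The right derivative of `x^K ψ(x)` is `x^{K-1}(x ψ'(x+) + K ψ(x)) ≤ 0`, and a continuous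
function with nonpositive right derivative does not increase. -/
theorem mul_rpow_le_of_alphaChar (hψ_pos : ∀ t, 1 ≤ t → 0 < ψ t)
    (hψ_anti : AntitoneOn ψ (Set.Ici 1)) (hp : 0 < p) {t₀ K : ℝ} (hK : 0 < K)
    (hconv : ConvexOn ℝ (Set.Ioi t₀) (fun t => ψ t ^ p))
    (hα : ∀ t, t₀ < t → K ≤ 1 / alphaChar ψ t) {t s : ℝ} (ht : 1 ≤ t) (ht₀ : t₀ < t)
    (hts : t ≤ s) : ψ s * s ^ K ≤ ψ t * t ^ K := by
  have hIcc : ∀ x ∈ Icc t s, 1 ≤ x ∧ t₀ < x := fun x hx => ⟨ht.trans hx.1, ht₀.trans_le hx.1⟩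
  -- Convexity enters here: `ψ^p` is continuous on the open ray, hence so is its `p`-th root.
  have hcont : ContinuousOn ψ (Icc t s) := by
    have h1 : ContinuousOn (fun x => (ψ x ^ p) ^ (1 / p)) (Icc t s) :=
      ((hconv.continuousOn isOpen_Ioi).mono fun x hx => (hIcc x hx).2).rpow_const
        fun x _ => Or.inr (by positivity)
    refine h1.congr fun x hx => ?_
    simp only
    rw [← Real.rpow_mul (hψ_pos x (hIcc x hx).1).le, mul_one_div_cancel hp.ne', Real.rpow_one]
  have hderiv : ∀ x ∈ Icc t s, DifferentiableWithinAt ℝ ψ (Ioi x) x ∧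
      derivWithin ψ (Ioi x) x * x ≤ - K * ψ x := by
    intro x hx
    obtain ⟨hx1, hx0⟩ := hIcc x hx
    have hψx := hψ_pos x hx1
    have h := hα x hx0
    rw [alphaChar, one_div_div] at h
    have h' := (le_div_iff₀ hψx).1 h
    have hd := derivWithin_nonpos_of_antitoneOn hψ_anti hx1
    rw [abs_of_nonpos hd] at h'
    refine ⟨?_, by linarith⟩
    -- Without a right derivative, `derivWithin` would be `0`, contradicting the positive lower
    -- bound.
    by_contra hnd
    rw [derivWithin_zero_of_not_differentiableWithinAt hnd] at h'
    have := mul_pos hK hψx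
    linarith [mul_neg x 0]
  have key := image_le_of_deriv_right_le_deriv_boundary (a := t) (b := s)
    (f := fun x => ψ x * x ^ K)
    (f' := fun x => derivWithin ψ (Ioi x) x * x ^ K + ψ x * (K * x ^ (K - 1)))
    (B := fun _ => ψ t * t ^ K) (B' := fun _ => 0)
    (hcont.mul (continuousOn_id.rpow_const fun x _ => Or.inr hK.le)) ?_ le_rfl
    continuousOn_const (fun x _ => hasDerivWithinAt_const _ _ _) ?_ (right_mem_Icc.2 hts)
  · exact key
  · intro x hx
    have hx' := Ico_subset_Icc_self hx
    have hx1 := (hIcc x hx').1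
    exact ((hderiv x hx').1.hasDerivWithinAt.Ici_of_Ioi).mul
      ((Real.hasDerivAt_rpow_const (Or.inl (by linarith))).hasDerivWithinAt)
  · intro x hx
    have hx' := Ico_subset_Icc_self hx
    have hx1 := (hIcc x hx').1
    have hx0 : 0 < x := by linarith
    have hxK : x ^ K = x ^ (K - 1) * x := by
      rw [← Real.rpow_add_one hx0.ne', sub_add_cancel]
    have h := (hderiv x hx').2
    have hpos : 0 < x ^ (K - 1) := by positivity
    calc derivWithin ψ (Ioi x) x * x ^ K + ψ x * (K * x ^ (K - 1))
        = x ^ (K - 1) * (derivWithin ψ (Ioi x) x * x - (- K * ψ x)) := by rw [hxK]; ring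
      _ ≤ 0 := mul_nonpos_of_nonneg_of_nonpos hpos.le (by linarith)

theorem exists_decay (hψ_pos : ∀ t, 1 ≤ t → 0 < ψ t)
    (hψ_anti : AntitoneOn ψ (Set.Ici 1)) (hp : 0 < p) {t₀ K : ℝ} (hK : 0 < K)
    (hconv : ConvexOn ℝ (Set.Ioi t₀) (fun t => ψ t ^ p))
    (hα : ∀ t, t₀ < t → K ≤ 1 / alphaChar ψ t) :
    ∃ C : ℝ, 0 < C ∧ ∀ t s, 1 ≤ t → t ≤ s → ψ s ≤ C * ψ t * (t / s) ^ K := by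
  obtain ⟨t₁, h1, h0⟩ : ∃ t₁ : ℝ, 1 ≤ t₁ ∧ t₀ < t₁ :=
    ⟨max 1 (t₀ + 1), le_max_left _ _, by linarith [le_max_right 1 (t₀ + 1)]⟩
  have main : ∀ t s, t₁ ≤ t → t ≤ s → ψ s ≤ ψ t * (t / s) ^ K := by
    intro t s ht hts
    have := mul_rpow_le_of_alphaChar hψ_pos hψ_anti hp hK hconv hα (h1.trans ht)
      (h0.trans_le ht) hts
    have ht0 : 0 < t := by linarith
    have hs0 : 0 < s := by linarith
    rw [Real.div_rpow ht0.le hs0.le, ← mul_div_assoc, le_div_iff₀ (by positivity)]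
    exact this
  -- The factor `t₁ ^ K` absorbs the range `[1, t₁]`, where only monotonicity is available.
  refine ⟨t₁ ^ K, by positivity, fun t s ht hts => ?_⟩
  have ht0 : 0 < t := by linarith
  have hs0 : 0 < s := by linarith
  have ht1 : 0 < t₁ := by linarith
  have hψt := hψ_pos t ht
  have rw1 : t₁ ^ K * ψ t * (t / s) ^ K = ψ t * (t₁ * (t / s)) ^ K := by
    rw [Real.mul_rpow ht1.le (by positivity)]; ring
  rw [rw1]
  rcases le_total t₁ t with h | h
  · refine (main t s h hts).trans ?_
    gcongr
    exact le_mul_of_one_le_left (by positivity) h1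
  · rcases le_total s t₁ with h' | h'
    · have : 1 ≤ t₁ * (t / s) := by
        rw [← mul_div_assoc, le_div_iff₀ hs0]
        nlinarith
      calc ψ s ≤ ψ t := hψ_anti ht (ht.trans hts) hts
        _ ≤ _ := le_mul_of_one_le_right hψt.le (Real.one_le_rpow this hK.le)
    · calc ψ s ≤ ψ t₁ * (t₁ / s) ^ K := main t₁ s le_rfl h'
        _ ≤ ψ t * (t₁ * (t / s)) ^ K := by
          have := hψ_anti ht h1 h
          rw [← mul_div_assoc]
          gcongr
          exact le_mul_of_one_le_right ht1.le ht

end Weight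


/-! ### Counting lattice points and summing over dyadic boxes -/

/-- The frequencies `k` all of whose coordinates satisfy `|k_j| < m`. -/
noncomputable def freqBox (d m : ℕ) : Finset (Fin d → ℤ) :=
  Fintype.piFinset fun _ => Finset.Ioo (-(m : ℤ)) m

theorem mem_freqBox {m : ℕ} {k : Fin d → ℤ} : k ∈ freqBox d m ↔ ∀ j, |k j| < m := by
  simp [freqBox, abs_lt]

theorem mem_freqBox_of_norm_lt {m : ℕ} {k : Fin d → ℤ} (h : ‖k‖ < m) : k ∈ freqBox d m :=
  mem_freqBox.2 fun j => by
    have := (norm_le_pi_norm k j).trans_lt h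
    rw [Int.norm_eq_abs] at this
    exact_mod_cast this

theorem norm_le_of_mem_freqBox {m : ℕ} {k : Fin d → ℤ} (h : k ∈ freqBox d (m + 1)) :
    ‖k‖ ≤ m :=
  (pi_norm_le_iff_of_nonneg (by positivity)).2 fun j => by
    have := Int.lt_add_one_iff.1 (by simpa using mem_freqBox.1 h j)
    rw [Int.norm_eq_abs]
    exact_mod_cast this

theorem card_freqBox (m : ℕ) : (freqBox d m).card = (2 * m - 1) ^ d := by
  rw [freqBox, Fintype.card_piFinset_const, Int.card_Ioo]
  congr 1
  omega

theorem card_freqBox_le (m : ℕ) : (freqBox d m).card ≤ (2 * m) ^ d := by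
  rw [card_freqBox]
  exact Nat.pow_le_pow_left (Nat.sub_le _ _) d

/-- The box of radius `2^{j+1} μ` has at most `(4 · 2^j μ)^d` points, and the matching weight is
`2^{-jβ}`: a geometric series of ratio `2^{d-β} < 1`. -/
theorem exists_tsum_rpow_le {β : ℝ} (hβ : (d : ℝ) < β) :
    ∃ C : ℝ≥0∞, C ≠ ⊤ ∧ ∀ μ : ℕ, 1 ≤ μ →
      ∑' k : Fin d → ℤ, ENNReal.ofReal ((μ / max (μ : ℝ) ‖k‖) ^ β) ≤ C * (μ : ℝ≥0∞) ^ d := by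
  set ρ : ℝ := 2 ^ ((d : ℝ) - β) with hρ
  have hρ0 : 0 < ρ := by positivity
  have hρ1 : ρ < 1 := Real.rpow_lt_one_of_one_lt_of_neg (by norm_num) (by linarith)
  have hρ1' : ENNReal.ofReal ρ < 1 := by
    rw [← ENNReal.ofReal_one]
    exact (ENNReal.ofReal_lt_ofReal_iff one_pos).2 hρ1
  have hβ0 : 0 ≤ β := (Nat.cast_nonneg d).trans hβ.le
  refine ⟨4 ^ d * (1 - ENNReal.ofReal ρ)⁻¹,
    ENNReal.mul_ne_top (by simp) (ENNReal.inv_ne_top.2 (tsub_pos_of_lt hρ1').ne'),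
    fun μ hμ => ?_⟩
  have hμ0 : (0 : ℝ) < μ := by exact_mod_cast hμ
  have hshell : ∀ k : Fin d → ℤ, ENNReal.ofReal ((μ / max (μ : ℝ) ‖k‖) ^ β) ≤
      ∑' j : ℕ, if k ∈ freqBox d (2 ^ (j + 1) * μ) then
        ENNReal.ofReal (((2 : ℝ) ^ j) ^ (-β)) else 0 := by
    intro k
    have hx : 1 ≤ max (μ : ℝ) ‖k‖ / μ := (one_le_div hμ0).2 (le_max_left _ _)
    obtain ⟨j, hj1, hj2⟩ := exists_nat_pow_near hx (one_lt_two)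
    rw [le_div_iff₀ hμ0] at hj1
    rw [div_lt_iff₀ hμ0] at hj2
    refine le_trans ?_ (ENNReal.le_tsum j)
    rw [if_pos (mem_freqBox_of_norm_lt (by push_cast; exact (le_max_right _ _).trans_lt hj2))]
    refine ENNReal.ofReal_le_ofReal ?_
    rw [Real.rpow_neg (by positivity), ← Real.inv_rpow (by positivity)]
    refine Real.rpow_le_rpow (by positivity) ?_ hβ0
    rw [div_le_iff₀ (lt_max_of_lt_left hμ0), inv_mul_eq_div, le_div_iff₀ (by positivity)]
    linarith
  calc ∑' k : Fin d → ℤ, ENNReal.ofReal ((μ / max (μ : ℝ) ‖k‖) ^ β)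
      ≤ ∑' k : Fin d → ℤ, ∑' j : ℕ, if k ∈ freqBox d (2 ^ (j + 1) * μ) then
        ENNReal.ofReal (((2 : ℝ) ^ j) ^ (-β)) else 0 := ENNReal.tsum_le_tsum hshell
    _ = ∑' j : ℕ, ((freqBox d (2 ^ (j + 1) * μ)).card : ℝ≥0∞) *
        ENNReal.ofReal (((2 : ℝ) ^ j) ^ (-β)) := by
      rw [ENNReal.tsum_comm]
      refine tsum_congr fun j => ?_
      rw [tsum_eq_sum (s := freqBox d (2 ^ (j + 1) * μ)) fun k hk => if_neg hk,
        Finset.sum_congr rfl fun k hk => if_pos hk, Finset.sum_const, nsmul_eq_mul]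
    _ ≤ ∑' j : ℕ, (4 ^ d * (μ : ℝ≥0∞) ^ d) * ENNReal.ofReal ρ ^ j := by
      refine ENNReal.tsum_le_tsum fun j => ?_
      have h1 : ((freqBox d (2 ^ (j + 1) * μ)).card : ℝ≥0∞) ≤
          4 ^ d * (μ : ℝ≥0∞) ^ d * ENNReal.ofReal (((2 : ℝ) ^ j) ^ (d : ℝ)) := by
        have : (freqBox d (2 ^ (j + 1) * μ)).card ≤ 4 ^ d * μ ^ d * (2 ^ j) ^ d := by
          refine (card_freqBox_le _).trans_eq ?_
          rw [← mul_pow, ← mul_pow]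
          ring
        rw [Real.rpow_natCast, ENNReal.ofReal_pow (by positivity), ENNReal.ofReal_pow (by norm_num),
          ENNReal.ofReal_ofNat]
        exact_mod_cast this
      calc _ ≤ 4 ^ d * (μ : ℝ≥0∞) ^ d * ENNReal.ofReal (((2 : ℝ) ^ j) ^ (d : ℝ)) *
            ENNReal.ofReal (((2 : ℝ) ^ j) ^ (-β)) := by gcongr
        _ = _ := by
          rw [mul_assoc, ← ENNReal.ofReal_mul (by positivity), ← Real.rpow_add (by positivity),
            ← ENNReal.ofReal_pow hρ0.le, ← sub_eq_add_neg, hρ, ← Real.rpow_natCast_mul (by norm_num),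
            ← Real.rpow_mul_natCast (by norm_num), mul_comm (j : ℝ)]
    _ = _ := by
      rw [ENNReal.tsum_mul_left, ENNReal.tsum_geometric]
      ring

/-! ### Two sequence inequalities, for `q ≤ p` and `p < q` -/

section Sequences

variable {ι : Type*} {p q : ℝ}

theorem tsum_le_of_rpow_le_one {x : ℝ≥0∞} (hq : 0 < q) (h : x ^ (1 / q) ≤ 1) : x ≤ 1 := by
  have := ENNReal.rpow_le_rpow h hq.le
  rwa [← ENNReal.rpow_mul, one_div_mul_cancel hq.ne', ENNReal.rpow_one, ENNReal.one_rpow] at this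

theorem exists_finset_tsum_rpow_le_of_le [DecidableEq ι] (hq : 0 < q) (hqp : q ≤ p) {b w : ι → ℝ≥0∞}
    (hb : ∑' k, b k ^ q ≤ 1) {A : Finset ι} {n : ℕ} (hA : 2 * A.card ≤ n)
    {M : ℝ≥0∞} (hw : ∀ k ∉ A, w k ≤ M) :
    ∃ A' : Finset ι, A'.card ≤ n ∧
      (∑' k, if k ∈ A' then 0 else (b k * w k) ^ p) ^ (1 / p)
        ≤ M * (2 / (n : ℝ≥0∞)) ^ (1 / q - 1 / p) := by
  have hp : 0 < p := hq.trans_le hqp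
  -- By Chebyshev at most `1/ε = n/2` indices have `b_k^q ≥ ε`; `A` takes the other half. On the
  -- rest, `b^p ≤ ε^{(p-q)/q} b^q`.
  set ε : ℝ≥0∞ := 2 / (n : ℝ≥0∞) with hε
  have hε0 : ε ≠ 0 := by simp [hε]
  obtain ⟨hfin, hcard⟩ := ENNReal.finset_card_const_le_le_of_tsum_le ENNReal.one_ne_top hb hε0
  have hcard' : 2 * hfin.toFinset.card ≤ n := by
    have hinv : 1 / ε = (n : ℝ≥0∞) / 2 := by
      rw [hε, one_div, ENNReal.inv_div (by simp) (by simp)]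
    rw [hinv, ENNReal.le_div_iff_mul_le (by simp) (by simp)] at hcard
    rw [mul_comm]
    exact_mod_cast hcard
  refine ⟨A ∪ hfin.toFinset, (Finset.card_union_le _ _).trans (by omega), ?_⟩
  have hterm : ∀ k, (if k ∈ A ∪ hfin.toFinset then 0 else (b k * w k) ^ p)
      ≤ M ^ p * ε ^ ((p - q) / q) * b k ^ q := by
    intro k
    split_ifs with hk
    · exact zero_le
    · simp only [Finset.mem_union, not_or, Set.Finite.mem_toFinset, Set.mem_ofPred_eq, not_le] at hk
      have hbp : b k ^ p ≤ ε ^ ((p - q) / q) * b k ^ q := by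
        calc b k ^ p = b k ^ (p - q) * b k ^ q := by
              rw [← ENNReal.rpow_add_of_nonneg _ _ (by linarith) hq.le, sub_add_cancel]
          _ = (b k ^ q) ^ ((p - q) / q) * b k ^ q := by
              rw [← ENNReal.rpow_mul, mul_div_cancel₀ _ hq.ne']
          _ ≤ _ := by
              have := div_nonneg (sub_nonneg.2 hqp) hq.le
              gcongr
              exact hk.2.le
      rw [ENNReal.mul_rpow_of_nonneg _ _ hp.le]
      calc b k ^ p * w k ^ p ≤ (ε ^ ((p - q) / q) * b k ^ q) * M ^ p := by
            gcongr
            exact hw k hk.1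
        _ = _ := by ring
  calc _ ≤ (M ^ p * ε ^ ((p - q) / q)) ^ (1 / p) := by
        refine ENNReal.rpow_le_rpow ?_ (by positivity)
        refine (ENNReal.tsum_le_tsum hterm).trans ?_
        rw [ENNReal.tsum_mul_left]
        exact mul_le_of_le_one_right zero_le hb
    _ = _ := by
        rw [ENNReal.mul_rpow_of_nonneg _ _ (by positivity), ← ENNReal.rpow_mul, ← ENNReal.rpow_mul,
          mul_one_div_cancel hp.ne', ENNReal.rpow_one]
        congr 2
        field_simp

theorem tsum_rpow_le_of_lt (hp : 0 < p) (hpq : p < q) {b w : ι → ℝ≥0∞}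
    (hb : ∑' k, b k ^ q ≤ 1) :
    (∑' k, (b k * w k) ^ p) ^ (1 / p)
      ≤ (∑' k, w k ^ (1 / p - 1 / q)⁻¹) ^ (1 / p - 1 / q) := by
  have hq : 0 < q := hp.trans hpq
  have he : 0 < 1 / p - 1 / q := sub_pos.2 (one_div_lt_one_div_of_lt hp hpq)
  set s := (1 / p - 1 / q)⁻¹ with hs
  have hs0 : 0 < s := inv_pos.2 he
  -- `1/s = 1/p - 1/q` is exactly conjugacy of `q/p` and `s/p`.
  have hconj : (q / p).HolderConjugate (s / p) := by
    refine Real.holderConjugate_iff.2 ⟨(one_lt_div hp).2 hpq, ?_⟩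
    rw [inv_div, inv_div, div_eq_mul_inv p s, hs, inv_inv]
    field_simp
    ring
  have hsum : ∑' k, (b k * w k) ^ p ≤ (∑' k, w k ^ s) ^ (p / s) := by
    rw [ENNReal.tsum_eq_iSup_sum]
    refine iSup_le fun F => ?_
    calc ∑ k ∈ F, (b k * w k) ^ p = ∑ k ∈ F, b k ^ p * w k ^ p := by
          simp only [ENNReal.mul_rpow_of_nonneg _ _ hp.le]
      _ ≤ (∑ k ∈ F, (b k ^ p) ^ (q / p)) ^ (1 / (q / p)) *
            (∑ k ∈ F, (w k ^ p) ^ (s / p)) ^ (1 / (s / p)) :=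
          ENNReal.inner_le_Lp_mul_Lq _ _ _ hconj
      _ ≤ 1 * (∑' k, w k ^ s) ^ (p / s) := by
          simp only [← ENNReal.rpow_mul, mul_div_cancel₀ _ hp.ne', one_div_div]
          gcongr
          · exact ENNReal.rpow_le_one ((ENNReal.sum_le_tsum F).trans hb) (by positivity)
          · exact ENNReal.sum_le_tsum F
      _ = _ := one_mul _
  calc _ ≤ ((∑' k, w k ^ s) ^ (p / s)) ^ (1 / p) :=
        ENNReal.rpow_le_rpow hsum (by positivity)
    _ = _ := by
        rw [← ENNReal.rpow_mul]
        congr 1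
        rw [← inv_inv (1 / p - 1 / q), ← hs]
        field_simp

end Sequences

/-! ### Upper and lower bounds for the class -/

section Bounds

variable {p q : ℝ} {ψ : ℝ → ℝ} {r : ℝ≥0∞}

theorem bestNTerm_le_of_mem_classF (hd : 1 ≤ d) (hp : 0 < p) (hq : 0 < q)
    (hψ_pos : ∀ t, 1 ≤ t → 0 < ψ t) (hr : 1 ≤ r) {f : (Fin d → ℝ) → ℂ}
    (hf : f ∈ classF d q r ψ) :
    ∃ b : (Fin d → ℤ) → ℝ≥0∞, ∑' k, b k ^ q ≤ 1 ∧
      ∀ (n : ℕ) (A : Finset (Fin d → ℤ)), A.card ≤ n → bestNTerm p n f ≤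
        (∑' k, if k ∈ A then 0 else
          (b k * ENNReal.ofReal (ψ (max 1 (vecNorm r k)))) ^ p) ^ (1 / p) := by
  -- Unification chooses `b_k = |f̂(k)| / ψ(|k|_r)`, which does not depend on `n`.
  refine ⟨_, tsum_le_of_rpow_le_one hq hf.2, fun n A hA => ?_⟩
  refine (bestNTerm_le hd hp hf.1 hA).trans_eq ?_
  congr 1
  refine tsum_congr fun k => ?_
  have hW := hψ_pos (max 1 (vecNorm r k)) (le_max_left _ _)
  have hW' : ENNReal.ofReal (ψ (max 1 (vecNorm r k)))
      = ‖((ψ (max 1 (vecNorm r k)) : ℝ) : ℂ)‖ₑ := by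
    rw [← ofReal_norm, Complex.norm_real, Real.norm_of_nonneg hW.le]
  beta_reduce
  rw [extendZero_vecNorm hr, hW', ← enorm_mul,
    div_mul_cancel₀ _ (Complex.ofReal_ne_zero.2 hW.ne')]

/-- The side of the frequency box removed in the `n`-term approximation. -/
theorem exists_side (hd : 1 ≤ d) {n : ℕ} (hn : 1 ≤ n) :
    ∃ m : ℕ, 2 * (2 * m) ^ d ≤ n ∧ max m 1 ^ d ≤ n ∧
      (n : ℝ) ^ (1 / (d : ℝ)) ≤ 8 * (max m 1 : ℕ) := by
  have hd0 : d ≠ 0 := by omega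
  set x := (n : ℝ) ^ (1 / (d : ℝ)) with hx
  have hxd : x ^ d = n := by
    rw [hx, one_div, Real.rpow_inv_natCast_pow (Nat.cast_nonneg n) hd0]
  have hx0 : 0 ≤ x := by positivity
  -- The quarter gives `(4m)^d ≤ n`, and `2 ≤ 2^d` then lets the box use only half of the budget. As
  -- `m` may be `0`, `ψ` is evaluated at `max m 1`; `x < 4(m + 1)` yields the factor `8`.
  set m := ⌊x / 4⌋₊ with hm
  have hm1 : (m : ℝ) ≤ x / 4 := Nat.floor_le (by positivity)
  have hm2 : x / 4 < m + 1 := Nat.lt_floor_add_one _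
  have h4 : (4 * m) ^ d ≤ n := by
    have : (4 * (m : ℝ)) ^ d ≤ x ^ d := pow_le_pow_left₀ (by positivity) (by linarith) d
    rw [hxd] at this
    exact_mod_cast this
  refine ⟨m, le_trans ?_ h4, ?_, ?_⟩
  · calc 2 * (2 * m) ^ d ≤ 2 ^ d * (2 * m) ^ d :=
          Nat.mul_le_mul_right _ (Nat.le_self_pow hd0 2)
      _ = (4 * m) ^ d := by rw [← mul_pow]; ring
  · rcases le_total m 1 with h | h
    · rw [max_eq_right h, one_pow]; exact hn
    · rw [max_eq_left h]
      exact (Nat.pow_le_pow_left (by omega) d).trans h4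
  · have h1 : (m : ℝ) ≤ (max m 1 : ℕ) := by exact_mod_cast le_max_left m 1
    have h2 : (1 : ℝ) ≤ (max m 1 : ℕ) := by exact_mod_cast le_max_right m 1
    linarith

theorem exists_upper_bound (hd : 1 ≤ d) (hp : 0 < p) (hq : 0 < q)
    (hψ_pos : ∀ t, 1 ≤ t → 0 < ψ t) (hψ_anti : AntitoneOn ψ (Set.Ici 1))
    (hψB : (fun t => ψ t ^ p) ∈ classB)
    (hψ_conv : p < q → ∃ t₀ : ℝ, ConvexOn ℝ (Set.Ioi t₀) (fun t => ψ t ^ p) ∧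
      ∃ Kψ : ℝ, (d : ℝ) * (1 / p - 1 / q) < Kψ ∧ ∀ t, t₀ < t → Kψ ≤ 1 / alphaChar ψ t)
    (hr : 1 ≤ r) :
    ∃ K : ℝ, 0 < K ∧ ∀ n : ℕ, 1 ≤ n → ∀ f ∈ classF d q r ψ, bestNTerm p n f ≤
      ENNReal.ofReal (K * (ψ ((n : ℝ) ^ (1 / (d : ℝ))) / (n : ℝ) ^ (1 / q - 1 / p))) := by
  obtain ⟨C, hC, hdoub⟩ := exists_doubling hψ_pos hψ_anti hp hψB 8
  suffices H : ∃ D : ℝ, 0 < D ∧ ∀ n m : ℕ, 1 ≤ n → 2 * (2 * m) ^ d ≤ n → max m 1 ^ d ≤ n →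
      ∀ f ∈ classF d q r ψ, bestNTerm p n f ≤
        ENNReal.ofReal (ψ (max m 1 : ℕ) * (D / (n : ℝ) ^ (1 / q - 1 / p))) by
    obtain ⟨D, hD, H⟩ := H
    refine ⟨C * D, by positivity, fun n hn f hf => ?_⟩
    obtain ⟨m, h1, h2, h3⟩ := exists_side hd hn
    refine (H n m hn h1 h2 f hf).trans (ENNReal.ofReal_le_ofReal ?_)
    have hn' : (1 : ℝ) ≤ n := by exact_mod_cast hn
    have := hdoub ((n : ℝ) ^ (1 / (d : ℝ))) (max m 1 : ℕ)
      (Real.one_le_rpow hn' (by positivity)) (by exact_mod_cast le_max_right m 1) h3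
    calc _ ≤ (C * ψ ((n : ℝ) ^ (1 / (d : ℝ)))) * (D / (n : ℝ) ^ (1 / q - 1 / p)) := by gcongr
      _ = _ := by ring
  have hmax : ∀ {m : ℕ} {k : Fin d → ℤ}, k ∉ freqBox d m →
      max ((max m 1 : ℕ) : ℝ) ‖k‖ ≤ max 1 (vecNorm r k) := by
    intro m k hk
    have h1 : (m : ℝ) ≤ ‖k‖ := not_lt.1 fun h => hk (mem_freqBox_of_norm_lt h)
    have h2 := norm_le_vecNorm hr k
    rw [Nat.cast_max, Nat.cast_one]
    exact max_le (max_le (le_max_of_le_right (h1.trans h2)) (le_max_left _ _))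
      (le_max_of_le_right h2)
  have hcard : ∀ {n m : ℕ}, 2 * (2 * m) ^ d ≤ n → 2 * (freqBox d m).card ≤ n := fun h =>
    (Nat.mul_le_mul_left 2 (card_freqBox_le _)).trans h
  rcases le_or_gt q p with hqp | hpq
  · refine ⟨2 ^ (1 / q - 1 / p), by positivity, fun n m hn h1 h2 f hf => ?_⟩
    obtain ⟨b, hb, hbest⟩ := bestNTerm_le_of_mem_classF hd hp hq hψ_pos hr hf
    have hμ : (1 : ℝ) ≤ (max m 1 : ℕ) := by exact_mod_cast le_max_right m 1
    have hn0 : (0 : ℝ) < n := by exact_mod_cast hn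
    obtain ⟨A, hA, hle⟩ := exists_finset_tsum_rpow_le_of_le hq hqp hb (hcard h1)
      (w := fun k => ENNReal.ofReal (ψ (max 1 (vecNorm r k))))
      (M := ENNReal.ofReal (ψ (max m 1 : ℕ))) (fun k hk => ENNReal.ofReal_le_ofReal
        (hψ_anti hμ (mem_Ici.2 (le_max_left _ _)) ((le_max_left _ _).trans (hmax hk))))
    refine (hbest n A hA).trans (hle.trans_eq ?_)
    rw [ENNReal.ofReal_mul (hψ_pos _ hμ).le, ← Real.div_rpow (by norm_num) hn0.le,
      ← ENNReal.ofReal_rpow_of_pos (by positivity), ENNReal.ofReal_div_of_pos hn0,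
      ENNReal.ofReal_natCast, ENNReal.ofReal_ofNat]
  · obtain ⟨t₀, hconv, K, hK, hα⟩ := hψ_conv hpq
    have he : 0 < 1 / p - 1 / q := sub_pos.2 (one_div_lt_one_div_of_lt hp hpq)
    set e := 1 / p - 1 / q with he'
    have hK0 : 0 < K := lt_of_le_of_lt (by positivity) hK
    obtain ⟨C₁, hC₁, hdecay⟩ := exists_decay hψ_pos hψ_anti hp hK0 hconv hα
    -- The assumed lower bound on `K` is precisely convergence of the lattice sum with Hölder
    -- exponent `e⁻¹`.
    have hβ : (d : ℝ) < K * e⁻¹ := by rwa [← div_eq_mul_inv, lt_div_iff₀ he]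
    obtain ⟨C₂, hC₂, hlat⟩ := exists_tsum_rpow_le hβ
    refine ⟨C₁ * (C₂.toReal + 1) ^ e, by positivity, fun n m hn h1 h2 f hf => ?_⟩
    obtain ⟨b, hb, hbest⟩ := bestNTerm_le_of_mem_classF hd hp hq hψ_pos hr hf
    have hμ : (1 : ℝ) ≤ (max m 1 : ℕ) := by exact_mod_cast le_max_right m 1
    have hn0 : (0 : ℝ) < n := by exact_mod_cast hn
    set μ := max m 1 with hμ'
    have hψμ := hψ_pos μ hμ
    have hw : ∀ k ∉ freqBox d m, ENNReal.ofReal (ψ (max 1 (vecNorm r k))) ≤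
        ENNReal.ofReal (C₁ * ψ μ) * ENNReal.ofReal ((μ / max (μ : ℝ) ‖k‖) ^ K) := by
      intro k hk
      rw [← ENNReal.ofReal_mul (by positivity)]
      refine ENNReal.ofReal_le_ofReal (le_trans ?_ (hdecay μ _ hμ (le_max_left _ ‖k‖)))
      exact hψ_anti (hμ.trans (le_max_left _ _)) (mem_Ici.2 (le_max_left _ _)) (hmax hk)
    have hsum : ∑' k : Fin d → ℤ, (ENNReal.ofReal (C₁ * ψ μ) *
        ENNReal.ofReal ((μ / max (μ : ℝ) ‖k‖) ^ K)) ^ e⁻¹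
        ≤ ENNReal.ofReal (C₁ * ψ μ) ^ e⁻¹ * ENNReal.ofReal ((C₂.toReal + 1) * n) := by
      have hpt : ∀ k : Fin d → ℤ, (ENNReal.ofReal (C₁ * ψ μ) *
          ENNReal.ofReal ((μ / max (μ : ℝ) ‖k‖) ^ K)) ^ e⁻¹ = ENNReal.ofReal (C₁ * ψ μ) ^ e⁻¹ *
          ENNReal.ofReal ((μ / max (μ : ℝ) ‖k‖) ^ (K * e⁻¹)) := by
        intro k
        rw [ENNReal.mul_rpow_of_nonneg _ _ (by positivity),
          ENNReal.ofReal_rpow_of_nonneg (x := (μ / max (μ : ℝ) ‖k‖) ^ K) (by positivity)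
            (by positivity),
          ← Real.rpow_mul (by positivity)]
      simp only [hpt]
      rw [ENNReal.tsum_mul_left]
      gcongr
      refine (hlat μ (le_max_right _ _)).trans ?_
      rw [ENNReal.ofReal_mul (by positivity), ENNReal.ofReal_natCast]
      gcongr
      · rw [← ENNReal.ofReal_toReal hC₂]
        exact ENNReal.ofReal_le_ofReal (by simp)
      · exact_mod_cast h2
    calc bestNTerm p n f ≤ _ := hbest n (freqBox d m) (by have := hcard h1; omega)
      _ ≤ (∑' k, (b k * (ENNReal.ofReal (C₁ * ψ μ) *
            ENNReal.ofReal ((μ / max (μ : ℝ) ‖k‖) ^ K))) ^ p) ^ (1 / p) := by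
          refine ENNReal.rpow_le_rpow (ENNReal.tsum_le_tsum fun k => ?_) (by positivity)
          split_ifs with hk
          · exact zero_le
          · have := hw k hk
            gcongr
      _ ≤ _ := tsum_rpow_le_of_lt hp hpq hb
      _ ≤ (ENNReal.ofReal (C₁ * ψ μ) ^ e⁻¹ * ENNReal.ofReal ((C₂.toReal + 1) * n)) ^ e :=
          ENNReal.rpow_le_rpow hsum he.le
      _ = _ := by
          rw [ENNReal.mul_rpow_of_nonneg _ _ he.le, ← ENNReal.rpow_mul, inv_mul_cancel₀ he.ne',
            ENNReal.rpow_one, ENNReal.ofReal_rpow_of_nonneg (by positivity) he.le,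
            ← ENNReal.ofReal_mul (by positivity), Real.mul_rpow (by positivity) (by positivity),
            show 1 / q - 1 / p = -e by rw [he']; ring, Real.rpow_neg hn0.le]
          congr 1
          rw [div_inv_eq_mul]
          ring

theorem exists_lower_bound (hd : 1 ≤ d) (hp : 0 < p) (hq : 0 < q)
    (hψ_pos : ∀ t, 1 ≤ t → 0 < ψ t) (hψ_anti : AntitoneOn ψ (Set.Ici 1))
    (hψB : (fun t => ψ t ^ p) ∈ classB) (hr : 1 ≤ r) :
    ∃ K : ℝ, 0 < K ∧ ∀ n : ℕ, 1 ≤ n → ∃ f ∈ classF d q r ψ,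
      ENNReal.ofReal (K * (ψ ((n : ℝ) ^ (1 / (d : ℝ))) / (n : ℝ) ^ (1 / q - 1 / p)))
        ≤ bestNTerm p n f := by
  -- Frequencies in the box have `|k|_r ≤ d M ≤ 2 d x`.
  obtain ⟨C, hC, hdoub⟩ := exists_doubling hψ_pos hψ_anti hp hψB (2 * d)
  refine ⟨C⁻¹ * 2 ^ (-(1 / q)), by positivity, fun n hn => ?_⟩
  have hd0 : d ≠ 0 := by omega
  have hd1 : (1 : ℝ) ≤ d := by exact_mod_cast hd
  have hn1 : (1 : ℝ) ≤ n := by exact_mod_cast hn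
  have hn0 : (0 : ℝ) < n := by linarith
  set x := (n : ℝ) ^ (1 / (d : ℝ)) with hx
  have hxd : x ^ d = n := by
    rw [hx, one_div, Real.rpow_inv_natCast_pow (Nat.cast_nonneg n) hd0]
  have hx1 : 1 ≤ x := Real.one_le_rpow hn1 (by positivity)
  set M := ⌈x⌉₊ with hM
  have hM1 : x ≤ M := Nat.le_ceil x
  have hM2 : (M : ℝ) ≤ 2 * x := by
    have := Nat.ceil_lt_add_one (by linarith : 0 ≤ x)
    linarith
  have hMn : n ≤ M ^ d := by
    have := pow_le_pow_left₀ (by linarith) hM1 d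
    rw [hxd] at this
    exact_mod_cast this
  have hbox : 2 * n ≤ (freqBox d (M + 1)).card := by
    rw [card_freqBox]
    calc 2 * n ≤ 2 ^ d * M ^ d := Nat.mul_le_mul (Nat.le_self_pow hd0 2) hMn
      _ = (2 * M) ^ d := (mul_pow _ _ _).symm
      _ ≤ _ := Nat.pow_le_pow_left (by omega) d
  obtain ⟨N, hNsub, hNcard⟩ := Finset.exists_subset_card_eq hbox
  have hR1 : (1 : ℝ) ≤ d * M := by nlinarith
  have hψR := hψ_pos _ hR1
  -- With this height each of the `2n` frequencies contributes at most `1/(2n)` to the class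
  -- constraint.
  set a : ℝ := (2 * n : ℝ) ^ (-(1 / q)) * ψ (d * M) with ha
  have ha0 : 0 ≤ a := by positivity
  refine ⟨fun y => ∑ k ∈ N, (a : ℂ) * trigExp k y, ⟨memL1_trigPoly N fun _ => (a : ℂ), ?_⟩, ?_⟩
  · refine ENNReal.rpow_le_one ?_ (by positivity)
    have hterm : ∀ k ∈ N, ‖fourierCoef (fun y => ∑ k ∈ N, (a : ℂ) * trigExp k y) k /
        (extendZero ψ (vecNorm r k) : ℂ)‖ₑ ^ q ≤ ENNReal.ofReal ((2 * n : ℝ)⁻¹) := by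
      intro k hk
      have hk1 : vecNorm r k ≤ d * M := (vecNorm_le_mul_norm hr k).trans
        (mul_le_mul_of_nonneg_left (norm_le_of_mem_freqBox (hNsub hk)) (by positivity))
      have hW := hψ_pos _ (le_max_left 1 (vecNorm r k))
      have hle : ψ (d * M) ≤ ψ (max 1 (vecNorm r k)) :=
        hψ_anti (mem_Ici.2 (le_max_left _ _)) hR1 (max_le hR1 hk1)
      rw [fourierCoef_trigPoly N fun _ => (a : ℂ), if_pos hk, extendZero_vecNorm hr,
        ← Complex.ofReal_div, ← ofReal_norm, Complex.norm_real,
        Real.norm_of_nonneg (by positivity), ENNReal.ofReal_rpow_of_nonneg (by positivity) hq.le]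
      refine ENNReal.ofReal_le_ofReal ?_
      calc (a / ψ (max 1 (vecNorm r k))) ^ q ≤ ((2 * n : ℝ) ^ (-(1 / q))) ^ q := by
            refine Real.rpow_le_rpow (by positivity) ?_ hq.le
            rw [div_le_iff₀ hW, ha]
            gcongr
        _ = _ := by
            rw [← Real.rpow_mul (by positivity), neg_mul, one_div_mul_cancel hq.ne',
              Real.rpow_neg_one]
    rw [tsum_eq_sum (s := N) fun k hk => by
      beta_reduce
      rw [fourierCoef_trigPoly N fun _ => (a : ℂ), if_neg hk]; simp [hq]]
    refine (Finset.sum_le_sum hterm).trans_eq ?_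
    rw [Finset.sum_const, hNcard, nsmul_eq_mul, ← ENNReal.ofReal_natCast,
      ← ENNReal.ofReal_mul (by positivity)]
    push_cast
    rw [mul_inv_cancel₀ (by positivity), ENNReal.ofReal_one]
  · refine le_trans ?_ (le_bestNTerm_trigPoly hp hNcard.ge (a : ℂ))
    rw [← ofReal_norm, Complex.norm_real, Real.norm_of_nonneg ha0,
      ENNReal.mul_rpow_of_nonneg _ _ (by positivity), ← ENNReal.rpow_mul,
      mul_one_div_cancel hp.ne', ENNReal.rpow_one, ← ENNReal.ofReal_natCast,
      ENNReal.ofReal_rpow_of_nonneg hn0.le (by positivity), ← ENNReal.ofReal_mul (by positivity)]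
    refine ENNReal.ofReal_le_ofReal ?_
    have hψx : C⁻¹ * ψ x ≤ ψ (d * M) := by
      rw [inv_mul_le_iff₀ hC]
      exact hdoub _ _ hR1 hx1 (by nlinarith)
    calc C⁻¹ * 2 ^ (-(1 / q)) * (ψ x / (n : ℝ) ^ (1 / q - 1 / p))
        = (n : ℝ) ^ (1 / p) * ((2 * n : ℝ) ^ (-(1 / q)) * (C⁻¹ * ψ x)) := by
          rw [Real.mul_rpow (by norm_num) hn0.le, div_eq_mul_inv (ψ x), ← Real.rpow_neg hn0.le,
            show -(1 / q - 1 / p) = 1 / p + -(1 / q) by ring, Real.rpow_add hn0]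
          ring
      _ ≤ _ := by rw [ha]; gcongr

end Bounds

end TrigApprox
theorem corollary4p1 (d : ℕ) (hd : 1 ≤ d) (p q : ℝ) (hp : 1 ≤ p) (hq : 0 < q)
    (ψ : ℝ → ℝ) (hψ_pos : ∀ t, 1 ≤ t → 0 < ψ t) (hψ_anti : AntitoneOn ψ (Set.Ici 1))
    (hψB : (fun t => ψ t ^ p) ∈ TrigApprox.classB)
    (hψ_conv : p < q → ∃ t₀ : ℝ, ConvexOn ℝ (Set.Ioi t₀) (fun t => ψ t ^ p) ∧
      ∃ Kψ : ℝ, (d : ℝ) * (1 / p - 1 / q) < Kψ ∧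
        ∀ t, t₀ < t → Kψ ≤ 1 / TrigApprox.alphaChar ψ t)
    (r : ℝ≥0∞) (hr : 1 ≤ r) :
    TrigApprox.SameOrder
      (fun n => TrigApprox.bestNTermClass p n (TrigApprox.classF d q r ψ))
      (fun n => ψ ((n : ℝ) ^ (1 / (d : ℝ))) / (n : ℝ) ^ (1 / q - 1 / p)) := by
  have hp0 : 0 < p := by linarith
  obtain ⟨K₁, hK₁, hlow⟩ := TrigApprox.exists_lower_bound hd hp0 hq hψ_pos hψ_anti hψB hr
  obtain ⟨K₂, hK₂, hup⟩ :=
    TrigApprox.exists_upper_bound hd hp0 hq hψ_pos hψ_anti hψB hψ_conv hr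
  -- Adding `K₁` makes the two constants strictly ordered.
  refine ⟨K₁, K₁ + K₂, hK₁, by linarith, fun n hn => ⟨?_, ?_⟩⟩
  · obtain ⟨f, hf, hle⟩ := hlow n hn
    exact hle.trans (le_iSup₂ (f := fun f _ => TrigApprox.bestNTerm p n f) f hf)
  · refine iSup₂_le fun f hf => (hup n hn f hf).trans (ENNReal.ofReal_le_ofReal ?_)
    have hn1 : (1 : ℝ) ≤ n := by exact_mod_cast hn
    have := hψ_pos _ (Real.one_le_rpow hn1 (by positivity : 0 ≤ 1 / (d : ℝ)))
    gcongr
    linarith
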